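/- **Theorem 2.1.** A quandle is a set $X$ with a binary operation $\lhd$ such that $a\lhd a=a$ for all $a$, the map $\bullet\lhd a: X\to X$ is bijective for all $a$, and $(a\lhd b)\lhd c=(a\lhd c)\lhd(b\lhd c)$ for all $a,b,c\in X$. Its adjoint group is $$\mathrm{As}(X)=\langle\, e_x\ (x\in X)\ \mid\ e_{x\lhd y}^{-1}e_y^{-1}e_xe_y\ (x,y\in X)\,\rangle ,$$ which acts on $X$ from the right by $x\cdot e_y=x\lhd y$. Let $\psi_X$ be the corresponding homomorphism from $\mathrm{As}(X)$ to the group of permutations of $X$ (acting on the right), and let $\mathrm{Inn}(X)$ be the image of $\psi_X$; the kernel $\mathrm{Ker}(\psi_X)$ is contained in the center of $\mathrm{As}(X)$. The quandle $X$ is connected if the action of $\mathrm{As}(X)$ on $X$ has exactly one orbit (in particular $X\neq\emptyset$). It is of type $t_X$ if $t_X$ is the least integer $N>0$ such that $(\cdots((x\lhd y)\lhd y)\cdots)\lhd y=x$ ($N$ operations by $y$) for all $x,y\in X$. For a group $G$ let $H_2^{\rm gr}(G)$ be its second homology with trivial integral coefficients. Let $X$ be a connected quandle, possibly infinite, of type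 $t_X$ (so $t_X<\infty$). Then $t_X\cdot H_2^{\rm gr}(\mathrm{As}(X))=0$. Furthermore, the abelian group $\mathrm{Ker}(\psi_X)$ is $[1/t_X]$-isomorphic to $\mathbb{Z}\oplus H_2^{\rm gr}(\mathrm{Inn}(X))$; that is, there is a group homomorphism $$f:\mathrm{Ker}(\psi_X)\longrightarrow \mathbb{Z}\oplus H_2^{\rm gr}(\mathrm{Inn}(X))$$ whose localization at $\ell$, namely $f\otimes\mathbb{Z}_{(\ell)}$, is an isomorphism for every prime $\ell$ that does not divide $t_X$. -/

import Mathlib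

universe u

namespace QuandleAdjoint

/-- The right quandle operation `x ◁ y`. Mathlib's `Quandle` is written as a left action, and
`Shelf.act y x` is the result of letting `y` act on `x`. With `x ◁ y := Shelf.act y x` Mathlib's
axioms read: `x ◁ x = x`, each `(• ◁ y)` is bijective, `(a ◁ b) ◁ c = (a ◁ c) ◁ (b ◁ c)`. -/
def rop {X : Type u} [Quandle X] (x y : X) : X := Shelf.act y x

/-- The quandle `X` is of type `t`: `t` is the least positive `N` such that
`(⋯((x ◁ y) ◁ y)⋯) ◁ y = x` (`N` times) for all `x`, `y`. -/
def IsOfType (X : Type u) [Quandle X] (t : ℕ) : Prop :=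
  IsLeast {N : ℕ | 0 < N ∧ ∀ x y : X, (fun z => rop z y)^[N] x = x} t

/-- The relators `e_{x ◁ y}⁻¹ e_y⁻¹ e_x e_y` of the adjoint group. -/
def relators (X : Type u) [Quandle X] : Set (FreeGroup X) :=
  {r | ∃ x y : X, r = (FreeGroup.of (rop x y))⁻¹ * (FreeGroup.of y)⁻¹ *
    FreeGroup.of x * FreeGroup.of y}

/-- The adjoint group `As(X) = ⟨ e_x (x ∈ X) | e_{x ◁ y}⁻¹ e_y⁻¹ e_x e_y ⟩`. -/
abbrev As (X : Type u) [Quandle X] : Type u := PresentedGroup (relators X)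

/-- The generator `e_x` of `As(X)`. -/
def e {X : Type u} [Quandle X] (x : X) : As X := PresentedGroup.of x

/-- The homomorphism `ψ_X` from `As(X)` to the permutation group of `X` with
`e_y ↦ (• ◁ y)`. As `As(X)` acts from the right, permutations are composed from left to right,
hence the opposite of Mathlib's `Equiv.Perm X`. -/
def psi (X : Type u) [Quandle X] : As X →* (Equiv.Perm X)ᵐᵒᵖ :=
  PresentedGroup.toGroup (f := fun y : X => MulOpposite.op (Rack.act' y)) (by
    rintro r ⟨x, y, rfl⟩
    simp only [map_mul, map_inv, FreeGroup.lift_apply_of, rop, Rack.ad_conj]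
    apply MulOpposite.unop_injective
    simp only [MulOpposite.unop_mul, MulOpposite.unop_inv, MulOpposite.unop_op,
      MulOpposite.unop_one]
    group)

/-- The right action `x · g` of `As(X)` on `X`, with `x · e_y = x ◁ y`. -/
def ract {X : Type u} [Quandle X] (x : X) (g : As X) : X := (psi X g).unop x

/-- `X` is connected: the right action of `As(X)` on `X` has exactly one orbit. -/
def IsConnected (X : Type u) [Quandle X] : Prop :=
  Nonempty X ∧ ∀ x y : X, ∃ g : As X, ract x g = y

/-- The inner automorphism group `Inn(X)`, the image of `ψ_X`. -/
abbrev Inn (X : Type u) [Quandle X] : Type u := (psi X).range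

theorem ract_e {X : Type u} [Quandle X] (x y : X) : ract x (e y) = rop x y := by
  simp [ract, e, psi, rop]

theorem e_rop {X : Type u} [Quandle X] (x y : X) : e (rop x y) = (e y)⁻¹ * e x * e y := by
  have h : PresentedGroup.mk (relators X) ((FreeGroup.of (rop x y))⁻¹ * (FreeGroup.of y)⁻¹ *
      FreeGroup.of x * FreeGroup.of y) = 1 :=
    PresentedGroup.one_of_mem ⟨x, y, rfl⟩
  have h' : (e (rop x y))⁻¹ * (e y)⁻¹ * e x * e y = 1 := by
    simpa [e, PresentedGroup.of] using h
  rw [mul_assoc, mul_assoc, inv_mul_eq_one] at h'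
  rw [h', mul_assoc]

theorem ract_mul {X : Type u} [Quandle X] (x : X) (g h : As X) :
    ract x (g * h) = ract (ract x g) h := by
  simp [ract]

theorem e_ract {X : Type u} [Quandle X] (g : As X) :
    ∀ x : X, e (ract x g) = g⁻¹ * e x * g := by
  have hg : g ∈ Subgroup.closure (Set.range (PresentedGroup.of (rels := relators X))) := by
    rw [PresentedGroup.closure_range_of]; trivial
  induction hg using Subgroup.closure_induction with
  | mem g hg =>
    obtain ⟨y, rfl⟩ := hg
    intro x
    exact (congrArg e (ract_e x y)).trans (e_rop x y)
  | one => intro x; simp [ract]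
  | mul g h _ _ ihg ihh => intro x; rw [ract_mul, ihh, ihg]; group
  | inv g _ ih =>
    intro x
    have h := ih (ract x g⁻¹)
    rw [← ract_mul, inv_mul_cancel] at h
    have h1 : ract x (1 : As X) = x := by simp [ract]
    rw [h1] at h
    rw [h]; group

/-- The kernel of `ψ_X` is contained in the centre of `As(X)`. -/
theorem ker_psi_le_center (X : Type u) [Quandle X] :
    (psi X).ker ≤ Subgroup.center (As X) := by
  intro g hg
  have hx : ∀ x : X, e x * g = g * e x := by
    intro x
    have h := e_ract g x
    have h1 : ract x g = x := by
      rw [MonoidHom.mem_ker] at hg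
      simp [ract, hg]
    rw [h1, mul_assoc, eq_inv_mul_iff_mul_eq] at h
    exact h.symm
  rw [Subgroup.mem_center_iff]
  intro a
  have ha : a ∈ Subgroup.closure (Set.range (PresentedGroup.of (rels := relators X))) := by
    rw [PresentedGroup.closure_range_of]; trivial
  have hle : Subgroup.closure (Set.range (PresentedGroup.of (rels := relators X))) ≤
      Subgroup.centralizer {g} := by
    rw [Subgroup.closure_le]
    rintro _ ⟨x, rfl⟩
    rw [SetLike.mem_coe, Subgroup.mem_centralizer_singleton_iff]
    exact hx x
  exact Subgroup.mem_centralizer_singleton_iff.mp (hle ha)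

/-- The kernel of `ψ_X` is an abelian group. -/
instance kerPsiCommGroup (X : Type u) [Quandle X] : CommGroup (psi X).ker :=
  { (inferInstance : Group (psi X).ker) with
    mul_comm := fun a b =>
      Subtype.ext (Subgroup.mem_center_iff.mp (ker_psi_le_center X b.2) a.1) }

/-- The second group homology `H₂(G; ℤ)` with trivial integral coefficients. Mathlib's
`groupHomology` wants the coefficient ring in the universe of `G`, hence `ULift ℤ`. -/
noncomputable abbrev H2 (G : Type u) [Group G] : Type u :=
  groupHomology (Rep.trivial (ULift.{u} ℤ) G (ULift.{u} ℤ)) 2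

/-- A homomorphism `f : A → B` of abelian groups is a `[1/N]`-isomorphism: its localization at
`ℓ` (at the prime ideal `(ℓ)` of `ℤ`) is bijective for each prime `ℓ` that does not divide `N`. -/
def IsInvIso {A B : Type u} [AddCommGroup A] [AddCommGroup B] (N : ℕ) (f : A →+ B) : Prop :=
  ∀ (l : ℕ) [Fact l.Prime], ¬ l ∣ N →
    Function.Bijective
      (LocalizedModule.map (Ideal.span {(l : ℤ)}).primeCompl f.toIntLinearMap)

end QuandleAdjoint

/-! Since `ℚ/ℤ` is divisible, second homology is detected by characters, and every character is the
evaluation of a `ℚ/ℤ`-valued 2-cocycle, which vanishes only if the cocycle is a coboundary. Torsion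
statements thus become statements about central extensions. Given a central extension of `As(X)`,
choose lifts `s x` of the generators. Connectedness and type `t` make `(s x)^t` central. Comparing
`t`-th powers shows that the failure of the `s x` to satisfy the quandle relations, raised to the
power `t`, can be absorbed by rescaling the lifts. Hence `t` times the cocycle splits
(`exists_nsmul_eq_coboundary`), and `t` annihilates `H₂(As X)`. For the kernel, `As(X)` is a central
extension of `Inn(X)`, and part of its five-term sequence is obtained by hand: the transgression
`H₂(Inn X) → Ker ψ` has kernel annihilated by `t`, and its image is the degree-zero part of `Ker ψ`.
The degree takes the value `t` on `e x ^ t`, so up to `t`-torsion phenomena `Ker ψ` splits as `ℤ ⊕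
H₂(Inn X)`. -/

namespace QuandleAdjoint

/-! ### 2-cocycles and their evaluation on second homology. -/

section TwoCocycle

variable {G H : Type u} [Group G] [Group H] {A B : Type*} [AddCommGroup A] [AddCommGroup B]

/-- A `2`-cocycle on `G` with values in the abelian group `A`, for the trivial action. -/
def IsTwoCocycle (f : G → G → A) : Prop :=
  ∀ g h k : G, f g h + f (g * h) k = f h k + f g (h * k)

/-- The coboundary of a function on a group, for the trivial action. -/
def coboundary (φ : G → A) (g h : G) : A := φ g + φ h - φ (g * h)

theorem IsTwoCocycle.map {f : G → G → A} (hf : IsTwoCocycle f) (α : A →+ B) :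
    IsTwoCocycle fun g h => α (f g h) := by
  intro g h k
  simp only [← map_add, hf g h k]

theorem IsTwoCocycle.comp {f : G → G → A} (hf : IsTwoCocycle f) (p : H →* G) :
    IsTwoCocycle fun g h => f (p g) (p h) := by
  intro g h k
  simp only [map_mul]
  exact hf _ _ _

theorem IsTwoCocycle.nsmul {f : G → G → A} (hf : IsTwoCocycle f) (n : ℕ) :
    IsTwoCocycle fun g h => n • f g h :=
  hf.map (nsmulAddMonoidHom n)

theorem IsTwoCocycle.one_left {f : G → G → A} (hf : IsTwoCocycle f) (g : G) :
    f 1 g = f 1 1 := by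
  have h := hf 1 1 g
  simp only [one_mul] at h
  exact (add_right_cancel h).symm

theorem IsTwoCocycle.one_right {f : G → G → A} (hf : IsTwoCocycle f) (g : G) :
    f g 1 = f 1 1 := by
  have h := hf g 1 1
  simp only [mul_one] at h
  exact add_right_cancel h

/-- The group of integral chains of degree two. -/
abbrev Chains₂ (G : Type u) : Type u := G × G →₀ ULift.{u} ℤ

/-- The trivial integral representation. -/
noncomputable abbrev trivialRep (G : Type u) [Group G] := Rep.trivial (ULift.{u} ℤ) G (ULift.{u} ℤ)

/-- The additive extension of a function of a set of generators to integral chains. -/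
noncomputable def evalChain {S : Type*} (f : S → A) : (S →₀ ULift.{u} ℤ) →+ A :=
  Finsupp.liftAddHom fun p => (zmultiplesHom A (f p)).comp AddEquiv.ulift.toAddMonoidHom

@[simp] theorem evalChain_single {S : Type*} (f : S → A) (p : S) (n : ULift.{u} ℤ) :
    evalChain f (Finsupp.single p n) = n.down • f p := by
  simp [evalChain]
  rfl

theorem addMonoidHom_eq_evalChain {S : Type*} (c : (S →₀ ULift.{u} ℤ) →+ A) :
    c = evalChain fun p => c (Finsupp.single p 1) := by
  ext p n
  simp only [AddMonoidHom.comp_apply, Finsupp.singleAddHom_apply, evalChain_single]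
  rw [← map_zsmul, Finsupp.smul_single]
  congr 2
  ext
  simp

open groupHomology in
theorem evalChain_d₃₂ {f : G → G → A} (hf : IsTwoCocycle f) (x : G × G × G →₀ ULift.{u} ℤ) :
    evalChain (fun p : G × G => f p.1 p.2) ((d₃₂ (trivialRep G)).hom x) = 0 := by
  induction x using Finsupp.induction_linear with
  | zero => simp
  | add x y hx hy => simp only [map_add, hx, hy, add_zero]
  | single p n =>
    obtain ⟨g, h, k⟩ := p
    have hd : (d₃₂ (trivialRep G)).hom (Finsupp.single (g, h, k) n) =
        Finsupp.single (h, k) n - Finsupp.single (g * h, k) n +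
          Finsupp.single (g, h * k) n - Finsupp.single (g, h) n :=
      d₃₂_single (A := trivialRep G) (g, h, k) n
    rw [hd]
    simp only [map_add, map_sub, evalChain_single, ← smul_add, ← smul_sub]
    rw [sub_add_eq_add_sub, ← hf g h k, add_sub_cancel_right, sub_self, smul_zero]

open groupHomology in
theorem evalChain_d₂₁ (φ : G → A) (x : Chains₂ G) :
    evalChain φ ((d₂₁ (trivialRep G)).hom x) =
      evalChain (fun p : G × G => coboundary φ p.1 p.2) x := by
  induction x using Finsupp.induction_linear with
  | zero => simp
  | add x y hx hy => simp only [map_add, hx, hy]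
  | single p n =>
    obtain ⟨g, h⟩ := p
    have hd : (d₂₁ (trivialRep G)).hom (Finsupp.single (g, h) n) =
        Finsupp.single h n - Finsupp.single (g * h) n + Finsupp.single g n :=
      d₂₁_single (A := trivialRep G) (g, h) n
    rw [hd]
    simp only [map_add, map_sub, evalChain_single, ← smul_add, ← smul_sub, coboundary]
    rw [sub_add_eq_add_sub, add_comm (φ h)]

/-- The class of a `2`-cycle in the second homology, as a homomorphism of additive groups. -/
noncomputable def cycleClass (G : Type u) [Group G] :
    groupHomology.cycles₂ (trivialRep G) →+ H2 G :=
  (groupHomology.H2π (trivialRep G)).hom.toAddMonoidHom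

theorem cycleClass_surjective : Function.Surjective (cycleClass G) := fun x => by
  induction x using groupHomology.H2_induction_on with
  | _ x => exact ⟨x, rfl⟩

theorem exists_d₃₂_eq_of_cycleClass_eq_zero {x : groupHomology.cycles₂ (trivialRep G)}
    (hx : cycleClass G x = 0) :
    ∃ y : G × G × G →₀ ULift.{u} ℤ, (groupHomology.d₃₂ (trivialRep G)).hom y = x.1 :=
  (groupHomology.H2π_eq_zero_iff (A := trivialRep G) x).mp hx

theorem cycleClass_d₃₂ (y : G × G × G →₀ ULift.{u} ℤ) :
    cycleClass G ⟨(groupHomology.d₃₂ (trivialRep G)).hom y,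
      groupHomology.d₃₂_apply_mem_cycles₂ (A := trivialRep G) y⟩ = 0 :=
  (groupHomology.H2π_eq_zero_iff (A := trivialRep G) _).mpr ⟨y, rfl⟩

/-- The evaluation of a function on pairs on the group of `2`-cycles. -/
noncomputable def evalCycle (f : G → G → A) : groupHomology.cycles₂ (trivialRep G) →+ A :=
  (evalChain fun p : G × G => f p.1 p.2).comp
    (groupHomology.cycles₂ (trivialRep G)).subtype.toAddMonoidHom

theorem ker_cycleClass_le {f : G → G → A} (hf : IsTwoCocycle f) :
    (cycleClass G).ker ≤ (evalCycle f).ker := by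
  intro x hx
  obtain ⟨y, hy⟩ := exists_d₃₂_eq_of_cycleClass_eq_zero hx
  change evalChain _ x.1 = 0
  rw [← hy]
  exact evalChain_d₃₂ hf y

/-- The evaluation of a `2`-cocycle on the second homology. -/
noncomputable def evalH2 (f : G → G → A) (hf : IsTwoCocycle f) : H2 G →+ A :=
  (cycleClass G).liftOfSurjective cycleClass_surjective ⟨evalCycle f, ker_cycleClass_le hf⟩

theorem evalH2_cycleClass {f : G → G → A} (hf : IsTwoCocycle f)
    (x : groupHomology.cycles₂ (trivialRep G)) :
    evalH2 f hf (cycleClass G x) = evalChain (fun p : G × G => f p.1 p.2) x.1 :=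
  AddMonoidHom.liftOfRightInverse_comp_apply _ _ _ ⟨evalCycle f, ker_cycleClass_le hf⟩ x

theorem evalChain_map {S : Type*} (f : S → A) (α : A →+ B) (x : S →₀ ULift.{u} ℤ) :
    evalChain (fun s => α (f s)) x = α (evalChain f x) := by
  induction x using Finsupp.induction_linear with
  | zero => simp
  | add x y hx hy => simp only [map_add, hx, hy]
  | single p n => simp only [evalChain_single, map_zsmul]

theorem evalChain_add {S : Type*} (f f' : S → A) (x : S →₀ ULift.{u} ℤ) :
    evalChain (fun s => f s + f' s) x = evalChain f x + evalChain f' x := by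
  induction x using Finsupp.induction_linear with
  | zero => simp
  | add x y hx hy => simp only [map_add, hx, hy]; exact add_add_add_comm _ _ _ _
  | single p n => simp only [evalChain_single, smul_add]

theorem evalH2_map {f : G → G → A} (hf : IsTwoCocycle f) (α : A →+ B) (x : H2 G) :
    evalH2 (fun g h => α (f g h)) (hf.map α) x = α (evalH2 f hf x) := by
  obtain ⟨x, rfl⟩ := cycleClass_surjective x
  rw [evalH2_cycleClass, evalH2_cycleClass]
  exact evalChain_map (fun p : G × G => f p.1 p.2) α x.1

/-- Cocycles that differ by a coboundary have the same evaluation. -/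
theorem evalH2_eq_of_eq_add_coboundary {f f' : G → G → A} (hf : IsTwoCocycle f)
    (hf' : IsTwoCocycle f') (φ : G → A) (h : ∀ g h, f g h = f' g h + coboundary φ g h) (x : H2 G) :
    evalH2 f hf x = evalH2 f' hf' x := by
  obtain ⟨x, rfl⟩ := cycleClass_surjective x
  rw [evalH2_cycleClass, evalH2_cycleClass]
  simp only [h]
  rw [evalChain_add (fun p : G × G => f' p.1 p.2) (fun p : G × G => coboundary φ p.1 p.2),
    ← evalChain_d₂₁]
  have hx : (groupHomology.d₂₁ (trivialRep G)).hom x.1 = 0 := x.2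
  rw [hx, map_zero, add_zero]

theorem evalH2_eq_zero_of_eq_coboundary {f : G → G → A} (hf : IsTwoCocycle f) (φ : G → A)
    (h : ∀ g k, f g k = coboundary φ g k) (x : H2 G) : evalH2 f hf x = 0 := by
  have h0 : IsTwoCocycle fun _ _ : G => (0 : A) := fun _ _ _ => rfl
  rw [evalH2_eq_of_eq_add_coboundary hf h0 φ (fun g k => by rw [zero_add, h])]
  exact evalH2_map h0 (0 : A →+ A) x

/-- The character descends to `C / ker p`, which embeds in `D`, and extends to `D` because `ℚ/ℤ` is
injective. -/
theorem exists_character_comp_eq {C D : Type*} [AddCommGroup C] [AddCommGroup D] (p : C →+ D)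
    (c : C →+ AddCircle (1 : ℚ)) (h : p.ker ≤ c.ker) :
    ∃ d : D →+ AddCircle (1 : ℚ), ∀ x, d (p x) = c x := by
  obtain ⟨d, hd⟩ := CharacterModule.dual_surjective_of_injective
    (QuotientAddGroup.kerLift p).toIntLinearMap (QuotientAddGroup.kerLift_injective p)
    (QuotientAddGroup.lift p.ker c h)
  exact ⟨d, fun x => DFunLike.congr_fun hd (QuotientAddGroup.mk x)⟩

/-- Each character of the second homology is the evaluation of a `2`-cocycle. -/
theorem exists_evalH2_eq (c : H2 G →+ AddCircle (1 : ℚ)) :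
    ∃ (f : G → G → AddCircle (1 : ℚ)) (hf : IsTwoCocycle f), evalH2 f hf = c := by
  let i : groupHomology.cycles₂ (trivialRep G) →+ Chains₂ G :=
    (groupHomology.cycles₂ (trivialRep G)).subtype.toAddMonoidHom
  -- Extend the character from cycles to all chains. Its values on basis elements form a cocycle
  -- because it vanishes on boundaries.
  obtain ⟨d, hd⟩ := exists_character_comp_eq i (c.comp (cycleClass G)) (by
    intro x hx
    have : x = 0 := Subtype.ext hx
    rw [this]
    exact map_zero _)
  let f : G → G → AddCircle (1 : ℚ) := fun g h => d (Finsupp.single (g, h) 1)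
  have hdf : d = evalChain fun p : G × G => f p.1 p.2 := addMonoidHom_eq_evalChain d
  have hf : IsTwoCocycle f := by
    intro g h k
    have h0 : (c.comp (cycleClass G)) _ = 0 :=
      (congrArg c (cycleClass_d₃₂ (Finsupp.single (g, h, k) 1))).trans (map_zero c)
    rw [← hd] at h0
    have h1 : (groupHomology.d₃₂ (trivialRep G)).hom (Finsupp.single (g, h, k) 1) =
        Finsupp.single (h, k) 1 - Finsupp.single (g * h, k) 1 +
          Finsupp.single (g, h * k) 1 - Finsupp.single (g, h) 1 :=
      groupHomology.d₃₂_single (A := trivialRep G) (g, h, k) 1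
    have h2 : d (Finsupp.single (h, k) 1 - Finsupp.single (g * h, k) 1 +
          Finsupp.single (g, h * k) 1 - Finsupp.single (g, h) 1) = 0 := by
      rw [← h1]
      exact h0
    simp only [map_add, map_sub] at h2
    rw [sub_eq_zero, sub_add_eq_add_sub, sub_eq_iff_eq_add] at h2
    exact h2.symm
  refine ⟨f, hf, AddMonoidHom.ext fun x => ?_⟩
  obtain ⟨x, rfl⟩ := cycleClass_surjective x
  rw [evalH2_cycleClass, ← hdf]
  exact hd x

/-- A `2`-cocycle with values in `ℚ/ℤ` whose evaluation vanishes is a coboundary. -/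
theorem exists_eq_coboundary_of_evalH2_eq_zero {f : G → G → AddCircle (1 : ℚ)}
    (hf : IsTwoCocycle f) (h0 : evalH2 f hf = 0) :
    ∃ φ : G → AddCircle (1 : ℚ), ∀ g h, f g h = coboundary φ g h := by
  -- Vanishing on all 2-cycles, that is on the kernel of `d₂₁`, lets the evaluation factor through
  -- `d₂₁`; the factor gives the cochain `φ`.
  obtain ⟨d, hd⟩ := exists_character_comp_eq
    (groupHomology.d₂₁ (trivialRep G)).hom.toAddMonoidHom
    (evalChain fun p : G × G => f p.1 p.2) (by
    intro x hx
    have h1 := evalH2_cycleClass hf ⟨x, hx⟩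
    rw [h0] at h1
    exact h1.symm)
  let φ : G → AddCircle (1 : ℚ) := fun g => d (Finsupp.single g 1)
  have hdφ : d = evalChain φ := addMonoidHom_eq_evalChain d
  refine ⟨φ, fun g h => ?_⟩
  have h1 := hd (Finsupp.single (g, h) 1)
  have h2 := evalChain_d₂₁ φ (Finsupp.single (g, h) 1)
  rw [← hdφ] at h2
  have h3 := h1.symm.trans h2
  simpa using h3

end TwoCocycle

/-! ### Central extensions defined by 2-cocycles. -/

section CentralExtension

theorem conj_mul_central {E : Type*} [Group E] {a b m n : E} (hm : ∀ w, Commute m w)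
    (hn : ∀ w, Commute n w) : (b * m)⁻¹ * (a * n) * (b * m) = b⁻¹ * a * b * n := by
  have h : (b * m)⁻¹ * (a * n) * (b * m) = m⁻¹ * (b⁻¹ * a * (n * b) * m) := by group
  rw [h, (hn b).eq, ← (hm _).eq, inv_mul_cancel_left, ← mul_assoc]

variable {G : Type u} [Group G] {A : Type*} [AddCommGroup A]

/-- The central extension of `G` by `A` defined by a `2`-cocycle. -/
structure CocycleExt (f : G → G → A) (hf : IsTwoCocycle f) where
  /-- The component in the kernel. -/
  fib : A
  /-- The component in the quotient. -/
  base : G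

namespace CocycleExt

variable {f : G → G → A} {hf : IsTwoCocycle f}

@[ext] theorem ext {u v : CocycleExt f hf} (h : u.fib = v.fib) (h' : u.base = v.base) : u = v := by
  cases u; cases v; simp_all

instance : Mul (CocycleExt f hf) := ⟨fun u v => ⟨u.fib + v.fib + f u.base v.base, u.base * v.base⟩⟩

/-- Cocycles are not assumed normalized, whence the corrections by `f 1 1` here, in the inverse and
in `incl`. -/
instance : One (CocycleExt f hf) := ⟨⟨-f 1 1, 1⟩⟩

instance : Inv (CocycleExt f hf) := ⟨fun u => ⟨-u.fib - f u.base⁻¹ u.base - f 1 1, u.base⁻¹⟩⟩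

@[simp] theorem mul_fib (u v : CocycleExt f hf) : (u * v).fib = u.fib + v.fib + f u.base v.base := rfl
@[simp] theorem mul_base (u v : CocycleExt f hf) : (u * v).base = u.base * v.base := rfl
@[simp] theorem one_fib : (1 : CocycleExt f hf).fib = -f 1 1 := rfl
@[simp] theorem one_base : (1 : CocycleExt f hf).base = 1 := rfl

instance : Group (CocycleExt f hf) :=
  Group.ofLeftAxioms
    (by
      intro u v w
      ext
      · have h := hf u.base v.base w.base
        simp only [mul_fib, mul_base]
        calc _ = u.fib + v.fib + w.fib + (f u.base v.base + f (u.base * v.base) w.base) := by abel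
          _ = _ := by rw [h]; abel
      · exact mul_assoc _ _ _)
    (by
      intro u
      ext
      · simp only [mul_fib, one_fib, one_base, hf.one_left]
        abel
      · exact one_mul _)
    (by
      intro u
      ext
      · change -u.fib - f u.base⁻¹ u.base - f 1 1 + u.fib + f u.base⁻¹ u.base = - f 1 1
        abel
      · exact inv_mul_cancel _)

/-- The projection of a central extension to its quotient. -/
def proj (hf : IsTwoCocycle f) : CocycleExt f hf →* G where
  toFun := base
  map_one' := rfl
  map_mul' _ _ := rfl

/-- The inclusion of the kernel in a central extension. -/
def incl (hf : IsTwoCocycle f) : Multiplicative A →* CocycleExt f hf where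
  toFun a := ⟨a.toAdd - f 1 1, 1⟩
  map_one' := by ext <;> simp
  map_mul' a b := by
    ext
    · simp only [toAdd_mul, mul_fib]
      abel
    · simp

theorem incl_mul_comm (a : Multiplicative A) (u : CocycleExt f hf) :
    incl hf a * u = u * incl hf a := by
  ext
  · change a.toAdd - f 1 1 + u.fib + f 1 u.base = u.fib + (a.toAdd - f 1 1) + f u.base 1
    rw [hf.one_left u.base, hf.one_right u.base]
    abel
  · change 1 * u.base = u.base * 1
    simp

theorem incl_injective : Function.Injective (incl hf) := fun a b h => by
  have h' : a.toAdd - f 1 1 = b.toAdd - f 1 1 := congrArg fib h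
  exact Multiplicative.toAdd.injective (sub_left_injective h')

theorem exists_eq_mul_incl {u v : CocycleExt f hf} (h : proj hf u = proj hf v) :
    ∃ a, u = v * incl hf a := by
  have h' : u.base = v.base := h
  refine ⟨.ofAdd (u.fib - v.fib), ?_⟩
  ext
  · change u.fib = v.fib + (u.fib - v.fib - f 1 1) + f v.base 1
    rw [hf.one_right v.base]
    abel
  · change u.base = v.base * 1
    rw [h', mul_one]

/-- The map of central extensions induced by multiplication by `n` on the cocycle. -/
def mapNSMul (hf : IsTwoCocycle f) (n : ℕ) : CocycleExt f hf →* CocycleExt _ (hf.nsmul n) where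
  toFun u := ⟨n • u.fib, u.base⟩
  map_one' := by ext <;> simp
  map_mul' u v := by ext <;> simp

theorem mapNSMul_incl (n : ℕ) (a : Multiplicative A) :
    mapNSMul hf n (incl hf a) = incl (hf.nsmul n) (a ^ n) := by
  ext
  · change n • (a.toAdd - f 1 1) = n • a.toAdd - n • f 1 1
    rw [smul_sub]
  · rfl

/-- A splitting of the central extension exhibits the cocycle as a coboundary. -/
theorem exists_eq_coboundary (s : G →* CocycleExt f hf) (hs : ∀ g, proj hf (s g) = g) :
    ∃ φ : G → A, ∀ g h, f g h = coboundary φ g h := by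
  refine ⟨fun g => -(s g).fib, fun g h => ?_⟩
  have h1 := congrArg fib (s.map_mul g h)
  have hg : (s g).base = g := hs g
  have hh : (s h).base = h := hs h
  rw [mul_fib, hg, hh] at h1
  rw [coboundary, h1]
  abel

end CocycleExt

end CentralExtension

/-! ### Central extensions of the adjoint group and the annihilation of its second homology. -/

section AdjointGroup

variable {X : Type u} [Quandle X]

theorem closure_range_e : Subgroup.closure (Set.range (e : X → As X)) = ⊤ :=
  PresentedGroup.closure_range_of _

theorem ract_e_pow (x y : X) (n : ℕ) : ract x (e y ^ n) = (fun z => rop z y)^[n] x := by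
  induction n with
  | zero => simp [ract]
  | succ n ih => rw [pow_succ, ract_mul, ih, ract_e, Function.iterate_succ_apply']

theorem mem_ker_psi {g : As X} : g ∈ (psi X).ker ↔ ∀ x, ract x g = x := by
  rw [MonoidHom.mem_ker]
  constructor
  · intro h x
    simp [ract, h]
  · intro h
    apply MulOpposite.unop_injective
    ext x
    exact h x

theorem IsOfType.e_pow_mem_ker {t : ℕ} (ht : IsOfType X t) (y : X) : e y ^ t ∈ (psi X).ker :=
  mem_ker_psi.mpr fun x => by rw [ract_e_pow]; exact ht.1.2 x y

theorem IsOfType.e_pow_mul_comm {t : ℕ} (ht : IsOfType X t) (y : X) (g : As X) :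
    e y ^ t * g = g * e y ^ t :=
  (Subgroup.mem_center_iff.mp (ker_psi_le_center X (ht.e_pow_mem_ker y)) g).symm

theorem IsConnected.exists_conj (hX : IsConnected X) (x y : X) :
    ∃ g : As X, e y = g⁻¹ * e x * g := by
  obtain ⟨g, rfl⟩ := hX.2 x y
  exact ⟨g, e_ract g x⟩

/-- All generators are conjugate by connectedness, and their `t`-th powers are central. -/
theorem IsConnected.e_pow_eq (hX : IsConnected X) {t : ℕ} (ht : IsOfType X t) (x y : X) :
    e x ^ t = e y ^ t := by
  obtain ⟨g, hg⟩ := hX.exists_conj x y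
  have h : (g⁻¹ * e x * g) ^ t = g⁻¹ * e x ^ t * g := by
    simpa using conj_pow (i := t) (a := g⁻¹) (b := e x)
  rw [hg, h, mul_assoc, ht.e_pow_mul_comm, inv_mul_cancel_left]

/-- Elements `s y` over the generators of `As(X)` that satisfy the quandle relations define a
homomorphism. -/
def liftAs {E : Type*} [Group E] (s : X → E) (hs : ∀ x y, s (rop x y) = (s y)⁻¹ * s x * s y) :
    As X →* E :=
  PresentedGroup.toGroup (f := s) (by
    rintro r ⟨x, y, rfl⟩
    simp only [map_mul, map_inv, FreeGroup.lift_apply_of, hs]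
    group)

@[simp] theorem liftAs_e {E : Type*} [Group E] (s : X → E)
    (hs : ∀ x y, s (rop x y) = (s y)⁻¹ * s x * s y) (x : X) : liftAs s hs (e x) = s x :=
  PresentedGroup.toGroup.of _

theorem hom_ext {E : Type*} [Group E] {p q : As X →* E} (h : ∀ x, p (e x) = q (e x)) : p = q :=
  PresentedGroup.ext h

open CocycleExt

variable {A : Type*} [AddCommGroup A] {f : As X → As X → A} {hf : IsTwoCocycle f}

/-- Any lift of `e y` is, up to the central kernel, a conjugate `v⁻¹ u v`. As `e x ^ t` is central,
`u ^ t` agrees up to the kernel with `(v⁻¹ u v) ^ t`, which commutes with `v⁻¹ u v`. So `u ^ t`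
commutes with lifts of generators, hence with everything. -/
theorem IsConnected.pow_central (hX : IsConnected X) {t : ℕ} (ht : IsOfType X t) {x : X}
    {u : CocycleExt f hf} (hu : proj hf u = e x) (w : CocycleExt f hf) : u ^ t * w = w * u ^ t := by
  suffices ∀ g : As X, ∀ w : CocycleExt f hf, proj hf w = g → Commute (u ^ t) w from
    this _ w rfl
  intro g
  have hg : g ∈ Subgroup.closure (Set.range (e : X → As X)) := by
    rw [closure_range_e]
    exact Subgroup.mem_top g
  induction hg using Subgroup.closure_induction with
  | mem g hg =>
    obtain ⟨y, rfl⟩ := hg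
    intro w hw
    obtain ⟨g, hg⟩ := hX.exists_conj x y
    let v : CocycleExt f hf := ⟨0, g⟩
    obtain ⟨a, ha⟩ : ∃ a, w = v⁻¹ * u * v * incl hf a := exists_eq_mul_incl (by
      simp only [map_mul, map_inv, hw, hu, hg]
      rfl)
    obtain ⟨b, hb⟩ : ∃ b, u ^ t = v⁻¹ * u ^ t * v * incl hf b := exists_eq_mul_incl (by
      simp only [map_mul, map_inv, map_pow, hu]
      rw [mul_assoc, ht.e_pow_mul_comm, inv_mul_cancel_left])
    have hc (c) (z : CocycleExt f hf) : Commute (incl hf c) z := incl_mul_comm c z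
    have h1 : Commute (v⁻¹ * u ^ t * v) (v⁻¹ * u * v) := by
      have h : v⁻¹ * u ^ t * v = (v⁻¹ * u * v) ^ t := by
        simpa using (conj_pow (i := t) (a := v⁻¹) (b := u)).symm
      rw [h]
      exact Commute.pow_self _ _
    rw [hb]
    refine Commute.mul_left ?_ (hc _ _)
    rw [ha]
    exact Commute.mul_right h1 (hc _ _).symm
  | one =>
    intro w hw
    obtain ⟨a, ha⟩ : ∃ a, w = 1 * incl hf a := exists_eq_mul_incl (by rw [hw, map_one])
    rw [ha, one_mul]
    exact (incl_mul_comm a _).symm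
  | mul g h _ _ ihg ihh =>
    intro w hw
    have := (ihg ⟨0, g⟩ rfl).mul_right (ihh ((⟨0, g⟩ : CocycleExt f hf)⁻¹ * w) (by
      rw [map_mul, map_inv, hw]
      exact inv_mul_cancel_left g h))
    rwa [mul_inv_cancel_left] at this
  | inv g _ ih =>
    intro w hw
    have := ih w⁻¹ (by rw [map_inv, hw, inv_inv])
    exact Commute.inv_right_iff.mp this

/-- If `X` is connected of type `t`, then `t` annihilates the classes of `2`-cocycles of
`As(X)`. -/
theorem IsConnected.exists_nsmul_eq_coboundary (hX : IsConnected X) {t : ℕ} (ht : IsOfType X t)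
    (hf : IsTwoCocycle f) : ∃ φ : As X → A, ∀ g h, t • f g h = coboundary φ g h := by
  obtain ⟨x₀⟩ := hX.1
  let s : X → CocycleExt f hf := fun x => ⟨0, e x⟩
  have hs (x) : proj hf (s x) = e x := rfl
  have hcent (x w) : s x ^ t * w = w * s x ^ t := hX.pow_central ht (hs x) w
  have hd (x) : ∃ a, s x ^ t = s x₀ ^ t * incl hf a := exists_eq_mul_incl (by
    rw [map_pow, map_pow, hs, hs, hX.e_pow_eq ht x x₀])
  choose d hd using hd
  have hc (x y) : ∃ a, (s y)⁻¹ * s x * s y = s (rop x y) * incl hf a := exists_eq_mul_incl (by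
    simp only [map_mul, map_inv, hs, e_rop])
  choose c hc using hc
  -- Conjugation fixes the central element `s x ^ t`; expanding both sides relative to `s x₀ ^ t`
  -- relates `d` and `c`.
  have hdc (x y) : d x = d (rop x y) * c x y ^ t := by
    have h1 : ((s y)⁻¹ * s x * s y) ^ t = s x ^ t := by
      have h : ((s y)⁻¹ * s x * s y) ^ t = (s y)⁻¹ * s x ^ t * s y := by
        simpa using conj_pow (i := t) (a := (s y)⁻¹) (b := s x)
      rw [h, mul_assoc, hcent, inv_mul_cancel_left]
    have hcomm : Commute (s (rop x y)) (incl hf (c x y)) := (incl_mul_comm _ _).symm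
    rw [hc, hcomm.mul_pow, hd (rop x y), hd x, mul_assoc, ← map_pow, ← map_mul] at h1
    exact (incl_injective (mul_left_cancel h1)).symm
  let ι := incl (hf.nsmul t)
  have hι (a w) : Commute (ι a) w := incl_mul_comm a w
  -- Multiplying the cocycle by `t` turns the defect `c x y` into its `t`-th power, which the
  -- correction by `d` cancels in view of `hdc`.
  let s' : X → CocycleExt _ (hf.nsmul t) := fun x => mapNSMul hf t (s x) * ι (d x)⁻¹
  have hs' (x y) : s' (rop x y) = (s' y)⁻¹ * s' x * s' y := by
    have h1 : (s' y)⁻¹ * s' x * s' y = mapNSMul hf t ((s y)⁻¹ * s x * s y) * ι (d x)⁻¹ := by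
      simp only [s', map_mul _ (_ * _), map_mul _ (_⁻¹), map_inv (mapNSMul hf t)]
      exact conj_mul_central (hι _) (hι _)
    rw [h1, hc, map_mul, mapNSMul_incl, mul_assoc, ← map_mul, hdc x y]
    simp [s', ι]
  refine exists_eq_coboundary (liftAs s' hs') fun g => ?_
  have h : (proj (hf.nsmul t)).comp (liftAs s' hs') = MonoidHom.id _ := hom_ext fun x => by
    rw [MonoidHom.comp_apply, liftAs_e]
    change e x * 1 = e x
    rw [mul_one]
  exact DFunLike.congr_fun h g

/-- If `X` is connected of type `t`, then `t` annihilates the second homology of `As(X)`. -/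
theorem IsConnected.nsmul_H2_As_eq_zero (hX : IsConnected X) {t : ℕ} (ht : IsOfType X t)
    (h : H2 (As X)) : t • h = 0 := by
  refine CharacterModule.eq_zero_of_character_apply fun c => ?_
  obtain ⟨f, hf, rfl⟩ := exists_evalH2_eq c
  obtain ⟨φ, hφ⟩ := hX.exists_nsmul_eq_coboundary ht hf
  have h1 := evalH2_map hf (nsmulAddMonoidHom t) h
  rw [evalH2_eq_zero_of_eq_coboundary (hf.map (nsmulAddMonoidHom t)) φ hφ] at h1
  exact (map_nsmul (evalH2 f hf) t h).trans h1.symm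

end AdjointGroup

/-! ### The central extension of `Inn(X)` by the kernel and its transgression. -/

section InnerExtension

variable {X : Type u} [Quandle X]

/-- The projection of `As(X)` to `Inn(X)`. -/
abbrev toInn (X : Type u) [Quandle X] : As X →* Inn X := (psi X).rangeRestrict

/-- A set-theoretic section of the projection of `As(X)` to `Inn(X)`. -/
noncomputable def innSection (q : Inn X) : As X :=
  Function.surjInv (psi X).rangeRestrict_surjective q

@[simp] theorem toInn_innSection (q : Inn X) : toInn X (innSection q) = q :=
  Function.surjInv_eq (psi X).rangeRestrict_surjective q

theorem mem_ker_psi_iff {g : As X} : g ∈ (psi X).ker ↔ toInn X g = 1 := by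
  rw [← MonoidHom.mem_ker, MonoidHom.ker_rangeRestrict]

theorem ker_mul_comm (k : (psi X).ker) (g : As X) : (k : As X) * g = g * k :=
  (Subgroup.mem_center_iff.mp (ker_psi_le_center X k.2) g).symm

/-- The `2`-cocycle of `Inn(X)` that classifies the central extension `As(X)`. -/
noncomputable def innCocycle (q q' : Inn X) : Additive (psi X).ker :=
  .ofMul ⟨innSection q * innSection q' * (innSection (q * q'))⁻¹,
    mem_ker_psi_iff.mpr (by simp only [map_mul, map_inv, toInn_innSection, mul_inv_cancel])⟩

theorem innSection_mul (q q' : Inn X) : innSection q * innSection q' =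
    ((innCocycle q q').toMul : As X) * innSection (q * q') := by
  simp [innCocycle]

theorem isTwoCocycle_innCocycle : IsTwoCocycle (innCocycle (X := X)) := by
  intro g h k
  apply Additive.toMul.injective
  apply Subtype.ext
  rw [toMul_add, toMul_add, Subgroup.coe_mul, Subgroup.coe_mul]
  apply mul_right_cancel (b := innSection (g * h * k))
  rw [mul_assoc, ← innSection_mul, ← mul_assoc, ← innSection_mul]
  rw [mul_assoc, mul_assoc g h k, mul_assoc, ← innSection_mul, innSection_mul h k,
    ← mul_assoc, ← mul_assoc, ker_mul_comm]

/-- The transgression from the second homology of `Inn(X)` to the kernel of `ψ_X`. -/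
noncomputable def transgression (X : Type u) [Quandle X] : H2 (Inn X) →+ Additive (psi X).ker :=
  evalH2 innCocycle isTwoCocycle_innCocycle

/-- The homomorphism from `As(X)` to `ℤ` that sends each generator to `1`. -/
def degree (X : Type u) [Quandle X] : As X →* Multiplicative ℤ :=
  liftAs (fun _ => .ofAdd 1) fun _ _ => by simp

@[simp] theorem degree_e (x : X) : degree X (e x) = .ofAdd 1 := liftAs_e _ _ _

/-- Conjugate generators have equal images in a commutative group, so the degree is the
abelianization. -/
theorem IsConnected.hom_eq (hX : IsConnected X) {M : Type*} [CommGroup M] (χ : As X →* M) (x : X)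
    (g : As X) : χ g = χ (e x) ^ (degree X g).toAdd := by
  have h : χ = (zpowersHom M (χ (e x))).comp (degree X) := hom_ext fun y => by
    obtain ⟨g, hg⟩ := hX.exists_conj x y
    rw [MonoidHom.comp_apply, degree_e, zpowersHom_apply, toAdd_ofAdd, zpow_one, hg, map_mul,
      map_mul, map_inv, mul_right_comm, inv_mul_cancel, one_mul]
  exact DFunLike.congr_fun h g

/-- The restriction of the degree to the kernel of `ψ_X`. -/
def kerDegree (X : Type u) [Quandle X] : Additive (psi X).ker →+ ℤ :=
  MonoidHom.toAdditiveLeft ((degree X).comp (psi X).ker.subtype)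

theorem kerDegree_apply (k : Additive (psi X).ker) :
    kerDegree X k = (degree X (k.toMul : As X)).toAdd := rfl

/-- The degree extends from the kernel to all of `As(X)`, so composing it with `innCocycle` gives
the coboundary of its values on the section. -/
theorem kerDegree_transgression (h : H2 (Inn X)) : kerDegree X (transgression X h) = 0 := by
  rw [transgression, ← evalH2_map]
  refine evalH2_eq_zero_of_eq_coboundary _ (fun q => (degree X (innSection q)).toAdd) ?_ h
  intro q q'
  have := congrArg (fun g => (degree X g).toAdd) (innSection_mul q q')
  simp only [map_mul, toAdd_mul] at this
  rw [coboundary, this, kerDegree_apply, add_sub_cancel_right]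

/-- The component of an element of `As(X)` in the kernel of `ψ_X`, relative to the section. -/
noncomputable def kerPart (g : As X) : Additive (psi X).ker :=
  .ofMul ⟨g * (innSection (toInn X g))⁻¹,
    mem_ker_psi_iff.mpr (by simp only [map_mul, map_inv, toInn_innSection, mul_inv_cancel])⟩

theorem kerPart_mul_innSection (g : As X) :
    ((kerPart g).toMul : As X) * innSection (toInn X g) = g := by
  simp [kerPart]

theorem kerPart_mul (g h : As X) :
    kerPart (g * h) = kerPart g + kerPart h + innCocycle (toInn X g) (toInn X h) := by
  apply Additive.toMul.injective
  apply Subtype.ext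
  rw [toMul_add, toMul_add, Subgroup.coe_mul, Subgroup.coe_mul]
  apply mul_right_cancel (b := innSection (toInn X (g * h)))
  rw [kerPart_mul_innSection, mul_assoc, map_mul, ← innSection_mul, ← mul_assoc,
    mul_assoc _ _ (innSection (toInn X g)), ker_mul_comm (kerPart h).toMul, ← mul_assoc,
    kerPart_mul_innSection, mul_assoc, kerPart_mul_innSection]

theorem kerPart_coe (k : (psi X).ker) : kerPart (k : As X) = .ofMul k - innCocycle 1 1 := by
  rw [eq_sub_iff_add_eq]
  apply Additive.toMul.injective
  apply Subtype.ext
  rw [toMul_add, Subgroup.coe_mul]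
  have h1 : toInn X (k : As X) = 1 := mem_ker_psi_iff.mp k.2
  have h2 := innSection_mul (1 : Inn X) 1
  rw [one_mul, mul_left_inj] at h2
  rw [← h2, ← h1, kerPart_mul_innSection]
  rfl

/-- The elements of degree zero in the kernel of `ψ_X` are in the image of the transgression. -/
theorem IsConnected.exists_transgression_eq (hX : IsConnected X) {k : Additive (psi X).ker}
    (hk : kerDegree X k = 0) : ∃ h, transgression X h = k := by
  change k ∈ (transgression X).range
  rw [← QuotientAddGroup.eq_zero_iff]
  refine CharacterModule.eq_zero_of_character_apply fun c' => ?_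
  let c : Additive (psi X).ker →+ AddCircle (1 : ℚ) :=
    AddMonoidHom.comp c' (QuotientAddGroup.mk' (transgression X).range)
  have hc (h : H2 (Inn X)) : c (transgression X h) = 0 := by
    have h0 : QuotientAddGroup.mk' (transgression X).range (transgression X h) = 0 :=
      (QuotientAddGroup.eq_zero_iff _).mpr ⟨h, rfl⟩
    exact (congrArg c' h0).trans (map_zero c')
  obtain ⟨φ, hφ⟩ := exists_eq_coboundary_of_evalH2_eq_zero (isTwoCocycle_innCocycle.map c)
    (AddMonoidHom.ext fun h => (evalH2_map isTwoCocycle_innCocycle c h).trans (hc h))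
  -- The trivialization `φ` of the pushed-out cocycle extends `c` to a character of `As(X)`, which
  -- factors through the degree and so is trivial on `k`.
  let χ : As X →* Multiplicative (AddCircle (1 : ℚ)) :=
    MonoidHom.mk' (fun g => .ofAdd (φ (toInn X g) + c (kerPart g))) fun g h => by
      apply Multiplicative.toAdd.injective
      simp only [toAdd_mul, toAdd_ofAdd, kerPart_mul, map_add, hφ, coboundary, map_mul]
      abel
  have hχ : χ (k.toMul : As X) = .ofAdd (c k) := by
    have h1 : toInn X (k.toMul : As X) = 1 := mem_ker_psi_iff.mp k.toMul.2
    have h2 : c (innCocycle 1 1) = φ 1 := by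
      rw [hφ, coboundary, mul_one, add_sub_cancel_right]
    apply Multiplicative.toAdd.injective
    change φ (toInn X k.toMul) + c (kerPart (k.toMul : As X)) = c k
    rw [h1, kerPart_coe, map_sub, h2, add_sub_cancel]
    rfl
  obtain ⟨x⟩ := hX.1
  have h := hX.hom_eq χ x (k.toMul : As X)
  rw [← kerDegree_apply, hk, zpow_zero, hχ] at h
  exact h

/-- If `X` is connected of type `t`, then `t` annihilates the kernel of the transgression. -/
theorem IsConnected.nsmul_eq_zero_of_transgression_eq_zero (hX : IsConnected X) {t : ℕ}
    (ht : IsOfType X t) {h : H2 (Inn X)} (h0 : transgression X h = 0) : t • h = 0 := by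
  refine CharacterModule.eq_zero_of_character_apply fun c => ?_
  obtain ⟨f, hf, rfl⟩ := exists_evalH2_eq c
  -- Inflated to `As(X)`, `t` times the cocycle is the coboundary of some `φ`. Up to a constant, `φ`
  -- restricts to a character of the kernel.
  obtain ⟨φ, hφ⟩ := hX.exists_nsmul_eq_coboundary ht (hf.comp (toInn X))
  have hker (k : (psi X).ker) (g : As X) :
      φ ((k : As X) * g) = φ k - t • f 1 1 + φ g := by
    have h1 := hφ k g
    rw [coboundary, mem_ker_psi_iff.mp k.2, hf.one_left] at h1
    rw [h1]
    abel
  let χ : Additive (psi X).ker →+ AddCircle (1 : ℚ) :=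
    AddMonoidHom.mk' (fun k => φ (k.toMul : As X) - t • f 1 1) fun k k' => by
      rw [toMul_add, Subgroup.coe_mul, hker]
      abel
  -- Evaluating `φ` along the section shows that `t • f` is cohomologous to `-χ` applied to
  -- `innCocycle`, so its evaluation factors through the transgression.
  have hcob (q q' : Inn X) : nsmulAddMonoidHom t (f q q') = (-χ) (innCocycle q q') +
      coboundary (fun q => φ (innSection q)) q q' := by
    have h1 := hφ (innSection q) (innSection q')
    rw [toInn_innSection, toInn_innSection, coboundary, innSection_mul, hker] at h1
    change t • f q q' = -(φ ((innCocycle q q').toMul : As X) - t • f 1 1) + _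
    rw [h1, coboundary]
    abel
  have h1 := evalH2_map hf (nsmulAddMonoidHom t) h
  rw [evalH2_eq_of_eq_add_coboundary _ (isTwoCocycle_innCocycle.map (-χ)) _ hcob,
    evalH2_map isTwoCocycle_innCocycle (-χ)] at h1
  change (-χ) (transgression X h) = _ at h1
  rw [h0, map_zero] at h1
  exact (map_nsmul (evalH2 f hf) t h).trans h1.symm

end InnerExtension

/-- A homomorphism whose kernel and cokernel are annihilated by `n` is an isomorphism after
localization at each prime that does not divide `n`. -/
theorem isInvIso_of_nsmul {A B : Type u} [AddCommGroup A] [AddCommGroup B] {t n : ℕ} (f : A →+ B)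
    (hn : ∀ l : ℕ, l.Prime → l ∣ n → l ∣ t) (hker : ∀ a, f a = 0 → n • a = 0)
    (hcoker : ∀ b, ∃ a, f a = n • b) : IsInvIso t f := by
  intro l hl hlt
  have hmem : (n : ℤ) ∈ (Ideal.span {(l : ℤ)}).primeCompl := by
    change ¬ (n : ℤ) ∈ Ideal.span {(l : ℤ)}
    rw [Ideal.mem_span_singleton, Int.natCast_dvd_natCast]
    exact fun h => hlt (hn l hl.out h)
  have hmap (a : A) (s : (Ideal.span {(l : ℤ)}).primeCompl) :
      LocalizedModule.map _ f.toIntLinearMap (LocalizedModule.mk a s) =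
        LocalizedModule.mk (f a) s := LocalizedModule.map_mk _ f.toIntLinearMap a s
  constructor
  · rw [injective_iff_map_eq_zero]
    intro x hx
    induction x using LocalizedModule.induction_on with
    | h a s =>
      rw [hmap, ← LocalizedModule.zero_mk s, LocalizedModule.mk_eq] at hx
      obtain ⟨u, hu⟩ := hx
      have h1 : f ((u : ℤ) • (s : ℤ) • a) = 0 := by
        rw [map_zsmul, map_zsmul]
        rw [smul_zero, smul_zero] at hu
        exact hu
      rw [← LocalizedModule.zero_mk s, LocalizedModule.mk_eq]
      refine ⟨⟨n, hmem⟩ * u, ?_⟩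
      have h2 := hker _ h1
      rw [← natCast_zsmul] at h2
      rw [smul_zero, smul_zero, mul_smul]
      exact h2
  · intro y
    induction y using LocalizedModule.induction_on with
    | h b s =>
      obtain ⟨a, ha⟩ := hcoker b
      refine ⟨LocalizedModule.mk a (⟨n, hmem⟩ * s), ?_⟩
      rw [hmap, ha, ← natCast_zsmul]
      exact LocalizedModule.mk_cancel_common_left
        (⟨n, hmem⟩ : (Ideal.span {(l : ℤ)}).primeCompl) s b

/-! ### The comparison map from the kernel to `ℤ ⊕ H₂(Inn X)`. -/

section KernelMap

variable {X : Type u} [Quandle X]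

/-- Multiplication by `t` kills the kernel of the transgression, so it descends to the image: an
inverse up to the factor `t`. -/
theorem IsConnected.exists_transgression_section (hX : IsConnected X) {t : ℕ}
    (ht : IsOfType X t) : ∃ g : (transgression X).range →+ H2 (Inn X),
      ∀ h, g ((transgression X).rangeRestrict h) = t • h := by
  let m : {m : H2 (Inn X) →+ H2 (Inn X) // (transgression X).rangeRestrict.ker ≤ m.ker} :=
    ⟨nsmulAddMonoidHom t, fun h hh =>
      hX.nsmul_eq_zero_of_transgression_eq_zero ht (congrArg Subtype.val hh)⟩
  exact ⟨(transgression X).rangeRestrict.liftOfSurjective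
    (transgression X).rangeRestrict_surjective m,
    fun h => AddMonoidHom.liftOfRightInverse_comp_apply _ _ _ m h⟩

theorem IsConnected.exists_isInvIso (hX : IsConnected X) {t : ℕ} (ht : IsOfType X t) :
    ∃ f : Additive (psi X).ker →+ ℤ × H2 (Inn X), IsInvIso t f := by
  obtain ⟨x⟩ := hX.1
  let z : Additive (psi X).ker := .ofMul ⟨e x ^ t, ht.e_pow_mem_ker x⟩
  have hz : kerDegree X z = t := by
    rw [kerDegree_apply]
    change (degree X (e x ^ t)).toAdd = t
    simp
  -- As `z` has degree `t`, this map kills `z` and lands in degree zero, which is the image of the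
  -- transgression; it acts there as `t`.
  let r : Additive (psi X).ker →+ Additive (psi X).ker :=
    nsmulAddMonoidHom t - (zmultiplesHom _ z).comp (kerDegree X)
  have hr (k) : r k = t • k - kerDegree X k • z := rfl
  obtain ⟨g, hg⟩ := hX.exists_transgression_section ht
  let r' : Additive (psi X).ker →+ (transgression X).range := r.codRestrict _ fun k =>
    hX.exists_transgression_eq (by rw [hr, map_sub, map_nsmul, map_zsmul, hz]; simp [mul_comm])
  have hrτ (h : H2 (Inn X)) :
      r' (transgression X h) = (transgression X).rangeRestrict (t • h) := Subtype.ext (by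
    change r _ = transgression X (t • h)
    rw [hr, kerDegree_transgression, zero_smul, sub_zero, map_nsmul])
  have hrz : r' z = 0 := Subtype.ext (by
    change r z = 0
    rw [hr, hz, natCast_zsmul, sub_self])
  let F : Additive (psi X).ker →+ ℤ × H2 (Inn X) := (kerDegree X).prod (g.comp r')
  have hF (k) : F k = (kerDegree X k, g (r' k)) := rfl
  -- One factor `t` comes from `r` and one from `g`.
  refine ⟨F, isInvIso_of_nsmul (n := t ^ 2) F (fun l hl h => hl.dvd_of_dvd_pow h) ?_ ?_⟩
  · intro k hk
    rw [hF, Prod.mk_eq_zero] at hk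
    obtain ⟨h, rfl⟩ := hX.exists_transgression_eq hk.1
    have h2 := hk.2
    rw [hrτ, hg, ← mul_smul, ← sq] at h2
    rw [← map_nsmul, h2, map_zero]
  · rintro ⟨m, h⟩
    refine ⟨(t * m) • z + transgression X h, ?_⟩
    rw [map_add, map_zsmul, hF, hF, hz, hrz, hrτ, hg, kerDegree_transgression, map_zero]
    ext
    · simp
      ring
    · simp [sq, mul_smul]

end KernelMap

end QuandleAdjoint

theorem theorem2p1 {X : Type u} [Quandle X] (t : ℕ)
    (hconn : QuandleAdjoint.IsConnected X) (htype : QuandleAdjoint.IsOfType X t) :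
    (∀ h : QuandleAdjoint.H2 (QuandleAdjoint.As X), t • h = 0) ∧
    ∃ f : Additive (QuandleAdjoint.psi X).ker →+ ℤ × QuandleAdjoint.H2 (QuandleAdjoint.Inn X),
      QuandleAdjoint.IsInvIso t f :=
  ⟨hconn.nsmul_H2_As_eq_zero htype, hconn.exists_isInvIso htype⟩
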